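/- Call a string of length $n$ non-repetitive if no character occurs twice in it. For two non-repetitive strings $A,B$ of length $n$ over a finite alphabet $\Sigma$ with $|\Sigma|\ge n$, let the Ulam distance $\mathrm{ud}(A,B)$ be the minimum number of character additions and character deletions (each of unit cost) that transform $A$ into $B$. For $\epsilon\in[0,1)$, a real number $r$ is a $(1+\epsilon)$-approximation of $\mathrm{ud}(A,B)$ if $(1-\epsilon)\,\mathrm{ud}(A,B)\le r\le(1+\epsilon)\,\mathrm{ud}(A,B)$. A quantum algorithm accesses $A$ and $B$ through the oracles $O_X\colon |i\rangle|a\rangle|z\rangle\mapsto|i\rangle|a\oplus X[i]\rangle|z\rangle$, $X\in\{A,B\}$, where $i\in\{1,\dots,n\}$, $a$ is the content of a character register, $z$ is the content of the work memory, and $\oplus$ is a fixed operation such that $a\mapsto a\oplus s$ is a permutation for every $s\in\Sigma$ (e.g. bitwise parity of binary encodings). It starts in a fixed basis state, performs a fixed sequence of steps, each of which is a unitary gate (from an arbitrary gate set) or a call to $O_A$ or $O_B$, and finally measures in the computational basis and outputs a real number computed from the result. Its running time is its number of steps. It computes a $(1+\epsilon)$-approximation of the Ulam distance with high probability if, for all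 non-repetitive strings $A,B\in\Sigma^n$, its output is a $(1+\epsilon)$-approximation of $\mathrm{ud}(A,B)$ with probability at least $9/10$. **Theorem.** For any $\epsilon\in[0,1)$, any quantum algorithm that computes with high probability a $(1+\epsilon)$-approximation of the Ulam distance of two non-repetitive strings of length $n$ requires $\Omega(\sqrt n)$ time. That is, there is a constant $c>0$ such that for every $n\ge 2$, every finite alphabet $\Sigma$ with $|\Sigma|\ge n$, and every choice of character register, operation $\oplus$, work memory and gate set, every such algorithm has running time at least $c\sqrt n$. -/

import Mathlib

namespace UlamLB

/-! ### Ulam distance -/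

/-- One edit operation on strings: insertion or deletion of a single character. -/
inductive EditStep {α : Type*} : List α → List α → Prop
  | add (u v : List α) (a : α) : EditStep (u ++ v) (u ++ a :: v)
  | del (u v : List α) (a : α) : EditStep (u ++ a :: v) (u ++ v)

/-- `EditPath k x y`: the string `x` can be transformed into `y` by exactly `k` operations. -/
inductive EditPath {α : Type*} : ℕ → List α → List α → Prop
  | refl (x : List α) : EditPath 0 x x
  | head {k : ℕ} {x y z : List α} : EditStep x y → EditPath k y z → EditPath (k + 1) x z

/-- Some sequence of operations always exists, so the minimum in `ulamDist` is over a
nonempty set. -/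
theorem exists_editPath {α : Type*} (x y : List α) : ∃ k, EditPath k x y := by
  induction x with
  | nil =>
    suffices h : ∀ u v : List α, ∃ k, EditPath k u (u ++ v) from h [] y
    intro u v
    induction v generalizing u with
    | nil => exact ⟨0, by simpa using EditPath.refl u⟩
    | cons a v ih =>
      obtain ⟨k, hk⟩ := ih (u ++ [a])
      refine ⟨k + 1, EditPath.head (y := u ++ [a]) ?_ (by simpa using hk)⟩
      simpa using EditStep.add u [] a
  | cons a x ih =>
    obtain ⟨k, hk⟩ := ih
    exact ⟨k + 1, EditPath.head (EditStep.del [] x a) hk⟩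

/-- The minimum number of character additions and deletions that transform the string `A`
into the string `B`. It is called the Ulam distance when `A` and `B` are non-repetitive, i.e.
injective. -/
noncomputable def ulamDist {α : Type*} {n : ℕ} (A B : Fin n → α) : ℕ :=
  sInf {k | EditPath k (List.ofFn A) (List.ofFn B)}

/-- The output `r` is a `(1 + ε)`-approximation of the Ulam distance of `A` and `B`. -/
def IsApprox {α : Type*} {n : ℕ} (ε : ℝ) (A B : Fin n → α) (r : ℝ) : Prop :=
  (1 - ε) * (ulamDist A B : ℝ) ≤ r ∧ r ≤ (1 + ε) * (ulamDist A B : ℝ)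

/-! ### Quantum algorithms with oracle access to two strings -/

/-- Computational basis states `|i⟩|r⟩|z⟩`: a position `i` of the strings, the content `r` of a
character register and the content `z` of the remaining (work) memory. -/
abbrev Basis (n : ℕ) (R W : Type*) : Type _ := Fin n × R × W

/-- The Hilbert space spanned by the basis states. -/
abbrev State (n : ℕ) (R W : Type*) : Type _ := EuclideanSpace ℂ (Basis n R W)

/-- Unitary operators on the Hilbert space. -/
abbrev UnitaryOp (n : ℕ) (R W : Type*) [Fintype R] [Fintype W] : Type _ :=
  State n R W ≃ₗᵢ[ℂ] State n R W

/-- The permutation `(i, r, z) ↦ (i, r ⊕ X[i], z)` of the basis states, where `r ⊕ a` is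
`shift a r`. -/
def oraclePerm {n : ℕ} {α R W : Type*} (shift : α → Equiv.Perm R) (X : Fin n → α) :
    Equiv.Perm (Basis n R W) where
  toFun b := (b.1, shift (X b.1) b.2.1, b.2.2)
  invFun b := (b.1, (shift (X b.1)).symm b.2.1, b.2.2)
  left_inv b := by simp
  right_inv b := by simp

/-- The oracle `O_X : |i⟩|r⟩|z⟩ ↦ |i⟩|r ⊕ X[i]⟩|z⟩` for the string `X`. -/
noncomputable def oracle {n : ℕ} {α R W : Type*} [Fintype R] [Fintype W]
    (shift : α → Equiv.Perm R) (X : Fin n → α) : UnitaryOp n R W :=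
  LinearIsometryEquiv.piLpCongrLeft 2 ℂ ℂ (oraclePerm shift X)

/-- The oracle acts on basis states as announced. -/
theorem oracle_single {n : ℕ} {α R W : Type*} [Fintype R] [Fintype W] [DecidableEq R]
    [DecidableEq W] (shift : α → Equiv.Perm R) (X : Fin n → α) (i : Fin n) (r : R) (z : W) :
    oracle shift X (EuclideanSpace.single ((i, r, z) : Basis n R W) (1 : ℂ)) =
      EuclideanSpace.single ((i, shift (X i) r, z) : Basis n R W) (1 : ℂ) :=
  LinearIsometryEquiv.piLpCongrLeft_single (oraclePerm shift X) _ _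

/-- One time step of a quantum algorithm: an elementary gate, taken from the gate set `G`, or a
call to one of the oracles `O_A` and `O_B`. -/
inductive QStep (n : ℕ) (R W : Type*) [Fintype R] [Fintype W] (G : Set (UnitaryOp n R W))
  | gate (U : UnitaryOp n R W) (hU : U ∈ G)
  | queryA
  | queryB

/-- The unitary operator performed by a step when the input is `(A, B)`. -/
noncomputable def QStep.op {n : ℕ} {R W : Type*} [Fintype R] [Fintype W]
    {G : Set (UnitaryOp n R W)} {α : Type*} (shift : α → Equiv.Perm R) (A B : Fin n → α) :
    QStep n R W G → UnitaryOp n R W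
  | .gate U _ => U
  | .queryA => oracle shift A
  | .queryB => oracle shift B

/-- A quantum algorithm (for strings of length `n`): it starts in a fixed basis state, performs a
fixed sequence of steps, then measures in the computational basis and outputs a real number
computed from the measured basis state. -/
structure QAlgorithm (n : ℕ) (R W : Type*) [Fintype R] [Fintype W]
    (G : Set (UnitaryOp n R W)) where
  init : Basis n R W
  steps : List (QStep n R W G)
  output : Basis n R W → ℝ

namespace QAlgorithm

variable {n : ℕ} {R W : Type*} [Fintype R] [Fintype W] {G : Set (UnitaryOp n R W)} {α : Type*}

/-- The running time: every gate and every oracle call takes one unit of time. -/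
def time (Q : QAlgorithm n R W G) : ℕ := Q.steps.length

open Classical in
/-- The state before the measurement, on input `(A, B)`. -/
noncomputable def finalState (Q : QAlgorithm n R W G) (shift : α → Equiv.Perm R)
    (A B : Fin n → α) : State n R W :=
  Q.steps.foldl (fun ψ s => s.op shift A B ψ) (EuclideanSpace.single Q.init 1)

open Classical in
/-- The probability that the output satisfies `P`, on input `(A, B)` (Born rule). -/
noncomputable def prob (Q : QAlgorithm n R W G) (shift : α → Equiv.Perm R)
    (A B : Fin n → α) (P : ℝ → Prop) : ℝ :=
  ∑ b : Basis n R W, if P (Q.output b) then ‖Q.finalState shift A B b‖ ^ 2 else 0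

/-- With high probability, i.e. with probability at least `9 / 10`, the algorithm outputs a
`(1 + ε)`-approximation of the Ulam distance, for all non-repetitive strings `A` and `B` of
length `n` over the alphabet `α`. -/
def ApproximatesUlam (Q : QAlgorithm n R W G) (shift : α → Equiv.Perm R) (ε : ℝ) : Prop :=
  ∀ A B : Fin n → α, Function.Injective A → Function.Injective B →
    9 / 10 ≤ Q.prob shift A B (IsApprox ε A B)

end QAlgorithm

end UlamLB

/-!
An approximation of `ud(A, A) = 0` must be exact, while one of `ud(A, B)` with `A ≠ B` must be
positive, so the final state on `(A, A)` is at a distance bounded below from the one on `(A, A ∘ τ)`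
for every nontrivial permutation `τ` of the positions. Take for `τ` the `n` transpositions of
cyclically adjacent positions.

Run the algorithm on all the inputs `(A, A ∘ τ)` at once, in the orthogonal sum of `n` copies of the
state space, and compare with `n` copies of the run on `(A, A)`. A call to `O_B` on a unit vector
moves them apart by a bounded amount in total: the call matters for `τ` only through the part of the
vector located at the two positions moved by `τ`, and each position is moved by only two of the `τ`.
As the final distance is of order `√n`, this takes of order `√n` calls.
-/

namespace UlamLB

section UlamDistance

variable {α : Type*} {n : ℕ} {A B : Fin n → α} {ε r : ℝ}

theorem editPath_zero_iff {x y : List α} : EditPath 0 x y ↔ x = y := by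
  refine ⟨fun h => ?_, fun h => h ▸ EditPath.refl x⟩
  cases h
  rfl

theorem ulamDist_eq_zero_iff : ulamDist A B = 0 ↔ A = B := by
  have hne : {k | EditPath k (List.ofFn A) (List.ofFn B)} ≠ ∅ :=
    Set.Nonempty.ne_empty (exists_editPath (List.ofFn A) (List.ofFn B))
  rw [ulamDist, Nat.sInf_eq_zero, or_iff_left hne, Set.mem_ofPred_eq, editPath_zero_iff,
    List.ofFn_inj]

theorem isApprox_self_iff : IsApprox ε A A r ↔ r = 0 := by
  simp only [IsApprox, ulamDist_eq_zero_iff.2 rfl, Nat.cast_zero, mul_zero, ge_antisymm_iff,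
    and_comm]

theorem IsApprox.pos (hε : ε < 1) (hAB : A ≠ B) (h : IsApprox ε A B r) : 0 < r := by
  have hd : (0 : ℝ) < ulamDist A B :=
    Nat.cast_pos.2 (Nat.pos_of_ne_zero (ulamDist_eq_zero_iff.not.2 hAB))
  exact (mul_pos (sub_pos.2 hε) hd).trans_le h.1

end UlamDistance

theorem le_norm_sub_sq_of_disjoint {𝕜 ι : Type*} [RCLike 𝕜] [Fintype ι] {s t : Finset ι}
    (hst : Disjoint s t) {ψ φ : EuclideanSpace 𝕜 ι} (hφ : ‖φ‖ ≤ 1) {p : ℝ}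
    (hs : p ≤ ∑ b ∈ s, ‖ψ b‖ ^ 2) (ht : p ≤ ∑ b ∈ t, ‖φ b‖ ^ 2) :
    3 / 2 * p - 1 ≤ ‖ψ - φ‖ ^ 2 := by
  classical
  have hφs : ∑ b ∈ s, ‖φ b‖ ^ 2 + ∑ b ∈ t, ‖φ b‖ ^ 2 ≤ 1 :=
    calc ∑ b ∈ s, ‖φ b‖ ^ 2 + ∑ b ∈ t, ‖φ b‖ ^ 2 = ∑ b ∈ s ∪ t, ‖φ b‖ ^ 2 :=
          (Finset.sum_union hst).symm
      _ ≤ ∑ b, ‖φ b‖ ^ 2 := by gcongr; exact Finset.subset_univ _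
      _ = ‖φ‖ ^ 2 := (EuclideanSpace.norm_sq_eq φ).symm
      _ ≤ 1 := pow_le_one₀ (norm_nonneg φ) hφ
  have hψs : ∑ b ∈ s, ‖ψ b‖ ^ 2 ≤ 2 * (∑ b ∈ s, ‖φ b‖ ^ 2 + ‖ψ - φ‖ ^ 2) :=
    calc ∑ b ∈ s, ‖ψ b‖ ^ 2 ≤ ∑ b ∈ s, 2 * (‖φ b‖ ^ 2 + ‖(ψ - φ) b‖ ^ 2) := by
          gcongr with b
          calc ‖ψ b‖ ^ 2 ≤ (‖φ b‖ + ‖(ψ - φ) b‖) ^ 2 := by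
                gcongr
                exact norm_le_norm_add_norm_sub' _ _
            _ ≤ 2 * (‖φ b‖ ^ 2 + ‖(ψ - φ) b‖ ^ 2) := add_sq_le
      _ = 2 * (∑ b ∈ s, ‖φ b‖ ^ 2 + ∑ b ∈ s, ‖(ψ - φ) b‖ ^ 2) := by
          rw [← Finset.mul_sum, Finset.sum_add_distrib]
      _ ≤ 2 * (∑ b ∈ s, ‖φ b‖ ^ 2 + ‖ψ - φ‖ ^ 2) := by
          rw [EuclideanSpace.norm_sq_eq (ψ - φ)]
          gcongr
          exact Finset.subset_univ _
  linarith

/-- Short maps do not amplify the errors made before, so the errors of the single steps add up. -/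
theorem dist_foldl_foldl_le {σ E F : Type*} [PseudoMetricSpace F] {U : E → σ → E} {V : F → σ → F}
    {S : Set E} {J : E → F} {K : σ → ℝ} (hU : ∀ x ∈ S, ∀ a, U x a ∈ S)
    (hV : ∀ a, LipschitzWith 1 (V · a)) (hK : ∀ x ∈ S, ∀ a, dist (J (U x a)) (V (J x) a) ≤ K a)
    (L : List σ) {x : E} (hx : x ∈ S) (y : F) :
    dist (J (L.foldl U x)) (L.foldl V y) ≤ dist (J x) y + (L.map K).sum := by
  induction L generalizing x y with
  | nil => simp
  | cons a L ih =>
    have hstep : dist (J (U x a)) (V y a) ≤ K a + dist (J x) y :=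
      (dist_triangle _ (V (J x) a) _).trans
        (add_le_add (hK x hx a) (by simpa using (hV a).dist_le_mul (J x) y))
    have htail := ih (hU x hx a) (V y a)
    simp only [List.foldl_cons, List.map_cons, List.sum_cons]
    linarith

section Oracle

variable {n : ℕ} {α R W : Type*}

/-- The part of the state `ψ` at which the position register holds `i`. Its squared norm is the
probability of observing `i` in that register. -/
def positionBlock (ψ : State n R W) (i : Fin n) : EuclideanSpace ℂ (R × W) :=
  WithLp.toLp 2 fun p => ψ (i, p)

theorem positionBlock_sub (ψ φ : State n R W) (i : Fin n) :
    positionBlock (ψ - φ) i = positionBlock ψ i - positionBlock φ i :=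
  rfl

variable [Fintype R] [Fintype W]

theorem sum_norm_positionBlock_sq (ψ : State n R W) :
    ∑ i, ‖positionBlock ψ i‖ ^ 2 = ‖ψ‖ ^ 2 := by
  simp only [EuclideanSpace.norm_sq_eq, Fintype.sum_prod_type, positionBlock]

theorem positionBlock_oracle (shift : α → Equiv.Perm R) (X : Fin n → α) (ψ : State n R W)
    (i : Fin n) :
    positionBlock (oracle shift X ψ) i =
      LinearIsometryEquiv.piLpCongrLeft 2 ℂ ℂ ((shift (X i)).prodCongr (Equiv.refl W))
        (positionBlock ψ i) :=
  rfl

theorem norm_oracle_sub_oracle_sq_le [DecidableEq α] (shift : α → Equiv.Perm R) (X Y : Fin n → α)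
    (ψ : State n R W) :
    ‖oracle shift X ψ - oracle shift Y ψ‖ ^ 2 ≤
      4 * ∑ i with X i ≠ Y i, ‖positionBlock ψ i‖ ^ 2 := by
  rw [← sum_norm_positionBlock_sq, Finset.mul_sum, Finset.sum_filter]
  gcongr with i
  rw [positionBlock_sub, positionBlock_oracle, positionBlock_oracle]
  split_ifs with hi
  · have h := norm_sub_le
      (LinearIsometryEquiv.piLpCongrLeft 2 ℂ ℂ ((shift (X i)).prodCongr (Equiv.refl W))
        (positionBlock ψ i))
      (LinearIsometryEquiv.piLpCongrLeft 2 ℂ ℂ ((shift (Y i)).prodCongr (Equiv.refl W))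
        (positionBlock ψ i))
    rw [LinearIsometryEquiv.norm_map, LinearIsometryEquiv.norm_map, ← two_mul] at h
    calc _ ≤ (2 * ‖positionBlock ψ i‖) ^ 2 := by gcongr
      _ = 4 * ‖positionBlock ψ i‖ ^ 2 := by ring
  · rw [not_not.1 hi, sub_self, norm_zero, sq, zero_mul]

theorem sum_norm_oracle_sub_oracle_sq_le {ι : Type*} [Fintype ι] [DecidableEq α]
    (shift : α → Equiv.Perm R) {X : Fin n → α} {Y : ι → Fin n → α} {d : ℕ}
    (hd : ∀ i, Finset.card {j | X i ≠ Y j i} ≤ d) (ψ : State n R W) :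
    ∑ j, ‖oracle shift X ψ - oracle shift (Y j) ψ‖ ^ 2 ≤ 4 * d * ‖ψ‖ ^ 2 :=
  calc ∑ j, ‖oracle shift X ψ - oracle shift (Y j) ψ‖ ^ 2
      ≤ ∑ j, 4 * ∑ i with X i ≠ Y j i, ‖positionBlock ψ i‖ ^ 2 :=
        Finset.sum_le_sum fun j _ => norm_oracle_sub_oracle_sq_le shift X (Y j) ψ
    _ = 4 * ∑ i, Finset.card {j | X i ≠ Y j i} * ‖positionBlock ψ i‖ ^ 2 := by
        simp only [← Finset.mul_sum, Finset.sum_filter]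
        rw [Finset.sum_comm]
        simp only [← Finset.sum_filter, Finset.sum_const, nsmul_eq_mul]
    _ ≤ 4 * ∑ i, d * ‖positionBlock ψ i‖ ^ 2 := by
        gcongr with i
        exact hd i
    _ = 4 * d * ‖ψ‖ ^ 2 := by
        rw [← Finset.mul_sum, sum_norm_positionBlock_sq, mul_assoc]

end Oracle

section Hybrid

variable {n : ℕ} {ι α R W : Type*} [Fintype R] [Fintype W] {G : Set (UnitaryOp n R W)}

/-- The number of calls to `O_B` made by a step: gates and calls to `O_A` are free. -/
def QStep.queryBCost : QStep n R W G → ℕ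
  | .queryB => 1
  | _ => 0

/-- The number of calls to `O_B` made by an algorithm. -/
def QAlgorithm.queryBCount (Q : QAlgorithm n R W G) : ℕ :=
  (Q.steps.map QStep.queryBCost).sum

theorem QAlgorithm.queryBCount_le_time (Q : QAlgorithm n R W G) : Q.queryBCount ≤ Q.time := by
  have hcost : ∀ s : QStep n R W G, s.queryBCost ≤ 1 := by
    rintro (_ | _ | _) <;> simp [QStep.queryBCost]
  simpa [queryBCount, time] using
    (Q.steps.map QStep.queryBCost).sum_le_card_nsmul 1 (by simpa using fun s _ => hcost s)

theorem norm_finalState (Q : QAlgorithm n R W G) (shift : α → Equiv.Perm R) (A B : Fin n → α) :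
    ‖Q.finalState shift A B‖ = 1 :=
  List.foldlRecOn (motive := fun ψ => ‖ψ‖ = 1) Q.steps _ (by simp) fun ψ hψ s _ =>
    ((s.op shift A B).norm_map ψ).trans hψ

theorem le_norm_finalState_sub_sq (Q : QAlgorithm n R W G) (shift : α → Equiv.Perm R)
    {A B A' B' : Fin n → α} {P P' : ℝ → Prop} {p : ℝ} (hP : ∀ r, P r → ¬ P' r)
    (h : p ≤ Q.prob shift A B P) (h' : p ≤ Q.prob shift A' B' P') :
    3 / 2 * p - 1 ≤ ‖Q.finalState shift A B - Q.finalState shift A' B'‖ ^ 2 := by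
  classical
  rw [QAlgorithm.prob, ← Finset.sum_filter] at h h'
  exact le_norm_sub_sq_of_disjoint (Finset.disjoint_filter.2 fun b _ => hP (Q.output b))
    (norm_finalState Q shift A' B').le h h'

variable [Fintype ι]

/-- The unitary operator performed by a step when the algorithm runs simultaneously on the inputs
`(A, Y j)`, in the orthogonal sum of one copy of the state space for each `j`. -/
noncomputable def QStep.jointOp (shift : α → Equiv.Perm R) (A : Fin n → α) (Y : ι → Fin n → α)
    (s : QStep n R W G) :
    PiLp 2 (fun _ : ι => State n R W) ≃ₗᵢ[ℂ] PiLp 2 (fun _ : ι => State n R W) :=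
  LinearIsometryEquiv.piLpCongrRight 2 fun j => s.op shift A (Y j)

theorem foldl_jointOp_apply (shift : α → Equiv.Perm R) (A : Fin n → α) (Y : ι → Fin n → α)
    (L : List (QStep n R W G)) (χ : PiLp 2 fun _ : ι => State n R W) (j : ι) :
    L.foldl (fun χ s => s.jointOp shift A Y χ) χ j =
      L.foldl (fun ψ s => s.op shift A (Y j) ψ) (χ j) :=
  (List.foldl_hom (fun χ : PiLp 2 fun _ : ι => State n R W => χ j) fun _ _ => rfl).symm

theorem dist_op_jointOp_le [DecidableEq α] (shift : α → Equiv.Perm R) (A : Fin n → α)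
    {X : Fin n → α} {Y : ι → Fin n → α} {d : ℕ} (hd : ∀ i, Finset.card {j | X i ≠ Y j i} ≤ d)
    (s : QStep n R W G) (ψ : State n R W) :
    dist (WithLp.toLp 2 fun _ : ι => s.op shift A X ψ)
        (s.jointOp shift A Y (WithLp.toLp 2 fun _ => ψ)) ≤
      2 * √d * ‖ψ‖ * s.queryBCost := by
  refine le_of_sq_le_sq ?_ (by positivity)
  rw [PiLp.dist_sq_eq_of_L2]
  cases s with
  | gate U hU => simp [QStep.op, QStep.jointOp, QStep.queryBCost]
  | queryA => simp [QStep.op, QStep.jointOp, QStep.queryBCost]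
  | queryB =>
    calc _ = ∑ j, ‖oracle shift X ψ - oracle shift (Y j) ψ‖ ^ 2 := by
          simp only [dist_eq_norm]
          rfl
      _ ≤ 4 * d * ‖ψ‖ ^ 2 := sum_norm_oracle_sub_oracle_sq_le shift hd ψ
      _ = _ := by
          simp only [QStep.queryBCost, Nat.cast_one, mul_one, mul_pow, Real.sq_sqrt d.cast_nonneg]
          norm_num

theorem sum_norm_finalState_sub_sq_le [DecidableEq α] (Q : QAlgorithm n R W G)
    (shift : α → Equiv.Perm R) (A : Fin n → α) {X : Fin n → α} {Y : ι → Fin n → α} {d : ℕ}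
    (hd : ∀ i, Finset.card {j | X i ≠ Y j i} ≤ d) :
    ∑ j, ‖Q.finalState shift A X - Q.finalState shift A (Y j)‖ ^ 2 ≤ 4 * d * Q.queryBCount ^ 2 := by
  classical
  let ψ₀ : State n R W := EuclideanSpace.single Q.init 1
  let J : State n R W → PiLp 2 (fun _ : ι => State n R W) := fun ψ => WithLp.toLp 2 fun _ => ψ
  have hdist : dist (J (Q.finalState shift A X))
      (Q.steps.foldl (fun χ s => s.jointOp shift A Y χ) (J ψ₀)) ≤ 2 * √d * Q.queryBCount := by
    have h := dist_foldl_foldl_le (S := Metric.sphere 0 1) (J := J)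
      (U := fun ψ s => s.op shift A X ψ) (V := fun χ s => s.jointOp shift A Y χ)
      (K := fun s => 2 * √d * s.queryBCost) (fun ψ hψ s => by simpa using hψ)
      (fun s => (s.jointOp shift A Y).lipschitz)
      (fun ψ hψ s => by
        simpa [mem_sphere_zero_iff_norm.1 hψ] using dist_op_jointOp_le shift A hd s ψ)
      Q.steps (x := ψ₀) (by simp [ψ₀]) (J ψ₀)
    rw [dist_self, zero_add, List.sum_map_mul_left] at h
    simpa [QAlgorithm.queryBCount, QAlgorithm.finalState, ψ₀, Nat.cast_list_sum,
      Function.comp_def] using h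
  calc ∑ j, ‖Q.finalState shift A X - Q.finalState shift A (Y j)‖ ^ 2
      = dist (J (Q.finalState shift A X))
          (Q.steps.foldl (fun χ s => s.jointOp shift A Y χ) (J ψ₀)) ^ 2 := by
        rw [PiLp.dist_sq_eq_of_L2]
        simp only [foldl_jointOp_apply, dist_eq_norm, J]
        rfl
    _ ≤ (2 * √d * Q.queryBCount) ^ 2 := by gcongr
    _ = 4 * d * Q.queryBCount ^ 2 := by
        rw [mul_pow, mul_pow, Real.sq_sqrt d.cast_nonneg]
        norm_num

/-- The hybrid argument of Bennett, Bernstein, Brassard and Vazirani. -/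
theorem card_mul_le_queryBCount_sq [DecidableEq α] (Q : QAlgorithm n R W G)
    (shift : α → Equiv.Perm R) {A X : Fin n → α} {Y : ι → Fin n → α} {d : ℕ}
    (hd : ∀ i, Finset.card {j | X i ≠ Y j i} ≤ d) {P : ℝ → Prop} {P' : ι → ℝ → Prop} {p : ℝ}
    (hP : ∀ j r, P r → ¬ P' j r) (hX : p ≤ Q.prob shift A X P)
    (hY : ∀ j, p ≤ Q.prob shift A (Y j) (P' j)) :
    Fintype.card ι * (3 / 2 * p - 1) ≤ 4 * d * Q.queryBCount ^ 2 :=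
  calc Fintype.card ι * (3 / 2 * p - 1) = ∑ _j : ι, (3 / 2 * p - 1) := by
        rw [Finset.sum_const, nsmul_eq_mul, Finset.card_univ]
    _ ≤ ∑ j, ‖Q.finalState shift A X - Q.finalState shift A (Y j)‖ ^ 2 :=
        Finset.sum_le_sum fun j _ => le_norm_finalState_sub_sq Q shift (hP j) hX (hY j)
    _ ≤ 4 * d * Q.queryBCount ^ 2 := sum_norm_finalState_sub_sq_le Q shift A hd

end Hybrid

theorem card_filter_ne_comp_swap_le {ι α : Type*} [Fintype ι] [DecidableEq ι] [DecidableEq α]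
    (A : ι → α) (f : Equiv.Perm ι) (i : ι) :
    Finset.card {j | A i ≠ (A ∘ Equiv.swap j (f j)) i} ≤ 2 := by
  refine (Finset.card_le_card (t := {i, f.symm i}) fun j hj => ?_).trans Finset.card_le_two
  simp only [Finset.mem_insert, Finset.mem_singleton, Equiv.eq_symm_apply]
  contrapose! hj
  simp [Equiv.swap_apply_of_ne_of_ne hj.1.symm hj.2.symm]

theorem comp_swap_ne {ι α : Type*} [DecidableEq ι] {A : ι → α} (hA : Function.Injective A)
    {i j : ι} (hij : j ≠ i) : A ≠ A ∘ Equiv.swap i j := fun h =>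
  hij (hA (by simpa using (congrFun h i).symm))

end UlamLB

theorem theorem10_general {ε : ℝ} (hε : ε < 1) {n : ℕ} (hn : 2 ≤ n) {α : Type*} (A : Fin n ↪ α)
    {R W : Type*} [Fintype R] [Fintype W] {shift : α → Equiv.Perm R}
    {G : Set (UlamLB.UnitaryOp n R W)} {Q : UlamLB.QAlgorithm n R W G}
    (hQ : Q.ApproximatesUlam shift ε) : 1 / 5 * √n ≤ Q.queryBCount := by
  classical
  let B : Fin n → Fin n → α := fun j => A ∘ Equiv.swap j (finRotate n j)
  have hAB (j : Fin n) : ⇑A ≠ B j := by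
    have hj : j ∈ (finRotate n).support := support_finRotate_of_le hn ▸ Finset.mem_univ j
    exact UlamLB.comp_swap_ne A.injective (Equiv.Perm.mem_support.1 hj)
  have hdisjoint (j : Fin n) (r : ℝ) : UlamLB.IsApprox ε A A r → ¬ UlamLB.IsApprox ε A (B j) r :=
    fun h h' => (h'.pos hε (hAB j)).ne' (UlamLB.isApprox_self_iff.1 h)
  have hquery : n * (3 / 2 * (9 / 10) - 1) ≤ 4 * 2 * (Q.queryBCount : ℝ) ^ 2 := by
    simpa using UlamLB.card_mul_le_queryBCount_sq Q shift
      (UlamLB.card_filter_ne_comp_swap_le A (finRotate n)) hdisjoint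
      (hQ A A A.injective A.injective)
      fun j => hQ A (B j) A.injective (A.injective.comp (Equiv.injective _))
  have hsqrt : √n ≤ 5 * Q.queryBCount := Real.sqrt_le_iff.2 ⟨by positivity, by nlinarith⟩
  linarith

/-- For every `ε ∈ [0, 1)` there is `c > 0` such that for all `n ≥ 2`, over every finite alphabet
that admits non-repetitive strings of length `n`, for every character register `R` with an
operation `r ⊕ a = shift a r`, every work memory `W` and every gate set `G`, each quantum algorithm
that computes with high probability a `(1 + ε)`-approximation of the Ulam distance takes time at
least `c √n`. -/
theorem theorem10 (ε : ℝ) (hε0 : 0 ≤ ε) (hε1 : ε < 1) :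
    ∃ c : ℝ, 0 < c ∧
      ∀ n : ℕ, 2 ≤ n →
      ∀ (α : Type*) [Fintype α], n ≤ Fintype.card α →
      ∀ (R W : Type*) [Fintype R] [Fintype W] (shift : α → Equiv.Perm R)
        (G : Set (UlamLB.UnitaryOp n R W)) (Q : UlamLB.QAlgorithm n R W G),
        Q.ApproximatesUlam shift ε →
        c * Real.sqrt (n : ℝ) ≤ (Q.time : ℝ) := by
  refine ⟨1 / 5, by norm_num, fun n hn α _ hα R W _ _ shift G Q hQ => ?_⟩
  obtain ⟨A⟩ : Nonempty (Fin n ↪ α) :=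
    Function.Embedding.nonempty_of_card_le ((Fintype.card_fin n).trans_le hα)
  exact (theorem10_general hε1 hn A hQ).trans (Nat.cast_le.2 Q.queryBCount_le_time)
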